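/- Fix a first-order language with variables, and let terms, atoms, substitutions, definite clauses and definite programs (finite sets of definite clauses) be taken over it. Let $U^E$ and $B^E$ be the sets of all terms, respectively all atoms (not necessarily ground), modulo renaming of variables. For a quasi-ordering (reflexive and transitive relation) $\succeq$ write $s\succ t$ if $s\succeq t$ and not $t\succeq s$; $\succeq$ is well-founded if there is no infinite sequence $s_0\succ s_1\succ\cdots$. For an atom $A$, $\mathrm{rel}(A)$ is its predicate. For predicates $p,q$ write $p\simeq q$ if $p$ and $q$ are mutually recursive in the program $P$, i.e. each depends on the other, where "depends on" is the reflexive transitive closure of "there is a clause of $P$ with $p$ in its head and $q$ in its body". For a set $S$ of atomic queries, $\mathrm{Call}(P,S)$ is the set of all atoms $A$ such that a variant of $A$ is selected in some SLD-derivation with the leftmost selection rule (LD-derivation) for $P$ and some query in $S$. **Theorem.** Let $S$ be a set of atomic queries and $P$ a definite program. Let $\geq$ be a quasi-ordering on $U^E$. For each predicate $p$ in $P$ let $R_p$ be a valid interargument relation for $p$, that is, a set of atoms of the form $p(t_1,\dots,t_n)$ containing every such atom with $P\models p(t_1,\dots,t_n)$ (i.e. whose universal closure is true in every model of $P$). Suppose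 that there is a well-founded quasi-ordering $\succeq$ on $U^E\cup B^E$ such that - $\succeq$ is a proper extension of $\geq$: for all $s,t\in U^E$, $s\geq t$ implies $s\succeq t$, and $s>t$ implies $s\succ t$; - $\succeq$ is rigid on $\mathrm{Call}(P,S)$: for all $A\in\mathrm{Call}(P,S)$ and all substitutions $\theta$, both $A\succeq A\theta$ and $A\theta\succeq A$; - for every clause $H\leftarrow B_1,\dots,B_n$ of $P$, every $i$ with $\mathrm{rel}(B_i)\simeq\mathrm{rel}(H)$, and every substitution $\theta$ with $B_j\theta\in R_{\mathrm{rel}(B_j)}$ for all $j<i$, one has $H\theta\succ B_i\theta$. Then $P$ is order-acceptable with respect to $S$: there is a well-founded quasi-ordering $\sqsupseteq$ on $U^E\cup B^E$, with strict part $\sqsupset$, such that $A\sqsupset B_i\theta\sigma$ for every $A\in\mathrm{Call}(P,S)$, every clause $A'\leftarrow B_1,\dots,B_n$ of $P$ (renamed apart from $A$) such that $A$ and $A'$ have a most general unifier $\theta$, every $i$ with $\mathrm{rel}(B_i)\simeq\mathrm{rel}(A)$, and every computed answer substitution $\sigma$ for $\leftarrow(B_1,\dots,B_{i-1})\theta$.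 Consequently every query in $S$ LD-terminates for $P$, i.e. its LD-tree (SLD-tree with the leftmost selection rule) is finite. -/

import Mathlib

universe u v

namespace LogicProgramming

/-! Terms, atoms, clauses and programs over a first-order language `L`.  Terms are Mathlib's
first-order terms with variables indexed by `ℕ`. -/

/-- A predicate symbol together with its arity. -/
abbrev Pred (L : FirstOrder.Language.{u, v}) : Type v := Σ n : ℕ, L.Relations n

/-- An atom `p(t₁, …, tₙ)`. -/
structure Atom (L : FirstOrder.Language.{u, v}) where
  arity : ℕ
  rel : L.Relations arity
  args : Fin arity → L.Term ℕ

/-- A definite clause `head ← body`. -/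
structure Clause (L : FirstOrder.Language.{u, v}) where
  head : Atom L
  body : List (Atom L)

/-- A definite program: a finite set of definite clauses. -/
abbrev Program (L : FirstOrder.Language.{u, v}) := Finset (Clause L)

/-- A query: a finite sequence of atoms. -/
abbrev Query (L : FirstOrder.Language.{u, v}) := List (Atom L)

/-- A substitution: it moves only finitely many variables. -/
structure Subst (L : FirstOrder.Language.{u, v}) where
  toFun : ℕ → L.Term ℕ
  finite_dom : {x | toFun x ≠ FirstOrder.Language.Term.var x}.Finite

variable {L : FirstOrder.Language.{u, v}}

namespace Subst

/-- The domain of a substitution. -/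
def dom (θ : Subst L) : Set ℕ := {x | θ.toFun x ≠ FirstOrder.Language.Term.var x}

/-- The variables of a substitution: those of its domain and of the terms they are mapped to. -/
def vars (θ : Subst L) : Set ℕ := θ.dom ∪ ⋃ x ∈ θ.dom, ((θ.toFun x).varFinset : Set ℕ)

/-- The empty substitution. -/
def id (L : FirstOrder.Language.{u, v}) : Subst L where
  toFun := FirstOrder.Language.Term.var
  finite_dom := by simp

/-- The composition `θσ`: first `θ`, then `σ`. -/
def comp (θ σ : Subst L) : Subst L where
  toFun x := (θ.toFun x).subst σ.toFun
  finite_dom := by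
    refine (θ.finite_dom.union σ.finite_dom).subset ?_
    intro x hx
    by_contra h
    simp only [Set.mem_union, Set.mem_ofPred_eq, not_or, not_not] at h
    apply hx
    rw [h.1]
    exact h.2

open Classical in
/-- The restriction of a substitution to a set of variables. -/
noncomputable def restrict (σ : Subst L) (V : Set ℕ) : Subst L where
  toFun x := if x ∈ V then σ.toFun x else FirstOrder.Language.Term.var x
  finite_dom := by
    refine σ.finite_dom.subset ?_
    intro x hx h
    apply hx
    show (if x ∈ V then σ.toFun x else FirstOrder.Language.Term.var x) = FirstOrder.Language.Term.var x
    split_ifs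
    · exact h
    · rfl

end Subst

namespace Atom

/-- `rel(A)`: the predicate occurring in `A`. -/
def pred (A : Atom L) : Pred L := ⟨A.arity, A.rel⟩

/-- `Aθ`. -/
def subst (A : Atom L) (θ : Subst L) : Atom L :=
  ⟨A.arity, A.rel, fun i => (A.args i).subst θ.toFun⟩

/-- Renaming of the variables of an atom. -/
def rename (e : Equiv.Perm ℕ) (A : Atom L) : Atom L :=
  ⟨A.arity, A.rel, fun i => (A.args i).relabel e⟩

/-- The variables of an atom. -/
def vars (A : Atom L) : Set ℕ := ⋃ i, ((A.args i).varFinset : Set ℕ)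

/-- Truth of an atom in a structure under an assignment of the variables. -/
def Holds {M : Type*} [L.Structure M] (w : ℕ → M) (A : Atom L) : Prop :=
  FirstOrder.Language.Structure.RelMap A.rel fun i => (A.args i).realize w

end Atom

/-- `Qθ`. -/
def Query.subst (Q : Query L) (θ : Subst L) : Query L := List.map (fun A => A.subst θ) Q

/-- The variables of a query. -/
def Query.vars (Q : Query L) : Set ℕ := {x | ∃ A ∈ Q, x ∈ A.vars}

namespace Clause

/-- Renaming of the variables of a clause. -/
def rename (e : Equiv.Perm ℕ) (c : Clause L) : Clause L :=
  ⟨c.head.rename e, c.body.map (Atom.rename e)⟩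

/-- The variables of a clause. -/
def vars (c : Clause L) : Set ℕ := c.head.vars ∪ Query.vars c.body

/-- `c'` is a variant of `c`. -/
def IsVariant (c c' : Clause L) : Prop := ∃ e : Equiv.Perm ℕ, c' = c.rename e

/-- Truth of (the universal closure of) a clause in a structure. -/
def TrueIn (M : Type*) [L.Structure M] (c : Clause L) : Prop :=
  ∀ w : ℕ → M, (∀ B ∈ c.body, B.Holds w) → c.head.Holds w

end Clause

/-- `P ⊨ A`: the universal closure of `A` is true in every model of `P`.  Models in the universe of
the function symbols are enough, because the set of all terms is the carrier of such a model. -/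
def Entails (P : Program L) (A : Atom L) : Prop :=
  ∀ (M : Type u) [Nonempty M] [L.Structure M],
    (∀ c ∈ P, c.TrueIn M) → ∀ w : ℕ → M, A.Holds w

/-! Extended Herbrand universe and base. -/

/-- The variant relation on terms. -/
def termVariant (L : FirstOrder.Language.{u, v}) : Setoid (L.Term ℕ) where
  r s t := ∃ e : Equiv.Perm ℕ, t = s.relabel e
  iseqv := by
    refine ⟨fun s => ⟨1, ?_⟩, ?_, ?_⟩
    · exact (FirstOrder.Language.Term.relabel_id s).symm
    · rintro s t ⟨e, rfl⟩
      refine ⟨e.symm, ?_⟩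
      simp [FirstOrder.Language.Term.relabel_relabel]
    · rintro s t r ⟨e, rfl⟩ ⟨f, rfl⟩
      refine ⟨e.trans f, ?_⟩
      simp [FirstOrder.Language.Term.relabel_relabel]

/-- The variant relation on atoms. -/
def atomVariant (L : FirstOrder.Language.{u, v}) : Setoid (Atom L) where
  r A B := ∃ e : Equiv.Perm ℕ, B = A.rename e
  iseqv := by
    refine ⟨fun A => ⟨1, ?_⟩, ?_, ?_⟩
    · cases A
      simp [Atom.rename, Equiv.Perm.coe_one, FirstOrder.Language.Term.relabel_id]
    · rintro A B ⟨e, rfl⟩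
      refine ⟨e.symm, ?_⟩
      cases A
      simp [Atom.rename, FirstOrder.Language.Term.relabel_relabel]
    · rintro A B C ⟨e, rfl⟩ ⟨f, rfl⟩
      refine ⟨e.trans f, ?_⟩
      cases A
      simp [Atom.rename, FirstOrder.Language.Term.relabel_relabel]

/-- The extended Herbrand universe `U^E`: terms modulo variants. -/
abbrev ExtUniverse (L : FirstOrder.Language.{u, v}) := Quotient (termVariant L)

/-- The extended Herbrand base `B^E`: atoms modulo variants. -/
abbrev ExtBase (L : FirstOrder.Language.{u, v}) := Quotient (atomVariant L)

/-- `U^E ∪ B^E`. -/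
abbrev ExtHerbrand (L : FirstOrder.Language.{u, v}) := ExtUniverse L ⊕ ExtBase L

/-- The class of an atom in `U^E ∪ B^E`. -/
def Atom.cls (A : Atom L) : ExtHerbrand L := Sum.inr (Quotient.mk (atomVariant L) A)

/-! Quasi-orderings. -/

/-- A quasi-ordering: a reflexive and transitive relation `≥`. -/
structure IsQuasiOrdering {α : Type*} (ge : α → α → Prop) : Prop where
  refl : ∀ a, ge a a
  trans : ∀ a b c, ge a b → ge b c → ge a c

/-- The associated ordering `>`. -/
def Gt {α : Type*} (ge : α → α → Prop) (a b : α) : Prop := ge a b ∧ ¬ ge b a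

/-- The associated equivalence. -/
def Equi {α : Type*} (ge : α → α → Prop) (a b : α) : Prop := ge a b ∧ ge b a

/-- There is no infinite descending sequence `s₀ > s₁ > …`. -/
def IsWellFounded {α : Type*} (ge : α → α → Prop) : Prop :=
  ¬ ∃ s : ℕ → α, ∀ n, Gt ge (s n) (s (n + 1))

/-- The quasi-ordering `ge'` on `U^E ∪ B^E` is a proper extension of the quasi-ordering `ge`
on `U^E`. -/
def IsProperExtension (ge : ExtUniverse L → ExtUniverse L → Prop)
    (ge' : ExtHerbrand L → ExtHerbrand L → Prop) : Prop :=
  (∀ s t, ge s t → ge' (Sum.inl s) (Sum.inl t)) ∧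
    (∀ s t, Gt ge s t → Gt ge' (Sum.inl s) (Sum.inl t))

/-- A quasi-ordering on `U^E ∪ B^E` is rigid on a set of atoms. -/
def IsRigidOn (ge : ExtHerbrand L → ExtHerbrand L → Prop) (X : Set (Atom L)) : Prop :=
  ∀ A ∈ X, ∀ θ : Subst L, Equi ge A.cls (A.subst θ).cls

/-! Predicate dependencies and interargument relations. -/

/-- The predicate `p` occurs in `P`. -/
def Occurs (P : Program L) (p : Pred L) : Prop :=
  ∃ c ∈ P, c.head.pred = p ∨ ∃ B ∈ c.body, B.pred = p

/-- `p` refers to `q` in `P`. -/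
def Refers (P : Program L) (p q : Pred L) : Prop :=
  ∃ c ∈ P, c.head.pred = p ∧ ∃ B ∈ c.body, B.pred = q

/-- `p` depends on `q` in `P`. -/
def DependsOn (P : Program L) : Pred L → Pred L → Prop := Relation.ReflTransGen (Refers P)

/-- `p` and `q` are mutually recursive in `P`. -/
def MutRec (P : Program L) (p q : Pred L) : Prop := DependsOn P p q ∧ DependsOn P q p

/-- `R` is a valid interargument relation for `p`: a set of atoms `p(t₁, …, tₙ)` that contains every
such atom which is a consequence of `P`. -/
structure IsValidInterarg (P : Program L) (p : Pred L) (R : Set (Atom L)) : Prop where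
  rel_subset : R ⊆ {A | A.pred = p}
  valid : ∀ A : Atom L, A.pred = p → Entails P A → A ∈ R

/-! SLD-resolution with the leftmost selection rule. -/

/-- `θ` is a most general unifier of `A` and `B`. -/
def IsMGU (θ : Subst L) (A B : Atom L) : Prop :=
  A.subst θ = B.subst θ ∧
    ∀ η : Subst L, A.subst η = B.subst η → ∃ δ : Subst L, η = θ.comp δ

/-- The data of a resolution step: the program clause, the variant of it that is used (the input
clause), and the most general unifier. -/
structure Step (L : FirstOrder.Language.{u, v}) where
  clause : Clause L
  input : Clause L
  mgu : Subst L

/-- `LDDerivation P Q₀ d Q`: the steps `d` form a finite LD-derivation for `P` that starts with the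
query `Q₀` and has arrived at the query `Q`.  The leftmost atom is selected in each step, and input
clauses are standardized apart: they share no variable with the initial query nor with the input
clauses and unifiers of the earlier steps. -/
inductive LDDerivation (P : Program L) (Q₀ : Query L) : List (Step L) → Query L → Prop
  | nil : LDDerivation P Q₀ [] Q₀
  | snoc {d : List (Step L)} {A : Atom L} {Q : Query L} (s : Step L)
      (hd : LDDerivation P Q₀ d (A :: Q))
      (clause_mem : s.clause ∈ P)
      (input_variant : s.clause.IsVariant s.input)
      (apart_query : Disjoint s.input.vars (Query.vars Q₀))
      (apart_steps : ∀ s' ∈ d, Disjoint s.input.vars s'.input.vars ∧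
        Disjoint s.input.vars s'.mgu.vars)
      (mgu : IsMGU s.mgu A s.input.head) :
      LDDerivation P Q₀ (d ++ [s]) (Query.subst (s.input.body ++ Q) s.mgu)

/-- The composition `θ₁θ₂⋯θₙ` of the unifiers of a derivation. -/
def composeMGUs (d : List (Step L)) : Subst L :=
  d.foldr (fun s σ => s.mgu.comp σ) (Subst.id L)

/-- `σ` is a computed answer substitution for `P` and the query `Q`: the composition of the unifiers
of a successful derivation, restricted to the variables of `Q`. -/
def IsComputedAnswer (P : Program L) (Q : Query L) (σ : Subst L) : Prop :=
  ∃ d : List (Step L), LDDerivation P Q d [] ∧ σ = (composeMGUs d).restrict (Query.vars Q)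

/-- `Call(P, S)`: the atoms of which a variant is selected in some LD-derivation for `P` and
some atomic query in `S`. -/
def Call (P : Program L) (S : Set (Atom L)) : Set (Atom L) :=
  {A | ∃ G ∈ S, ∃ (d : List (Step L)) (e : Equiv.Perm ℕ) (Q : Query L),
    LDDerivation P [G] d (A.rename e :: Q)}

/-- `T` is an LD-tree for `P` and `G`.  A node is given by the derivation along the branch from the
root to it, and it has exactly one child for each clause of `P` that can be used to prolong that
derivation. -/
structure IsLDTree (P : Program L) (G : Query L) (T : Set (List (Step L))) : Prop where
  root : [] ∈ T
  branch : ∀ d ∈ T, ∃ Q, LDDerivation P G d Q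
  parent : ∀ d s, d ++ [s] ∈ T → d ∈ T
  child : ∀ d ∈ T, ∀ c ∈ P, (∃ s Q, s.clause = c ∧ LDDerivation P G (d ++ [s]) Q) →
    ∃! s : Step L, s.clause = c ∧ d ++ [s] ∈ T

/-- `G` LD-terminates for `P`: the LD-tree (unique up to the choice of variants and unifiers)
is finite, whatever these choices are. -/
def LDTerminates (P : Program L) (G : Query L) : Prop :=
  ∀ T : Set (List (Step L)), IsLDTree P G T → T.Finite

/-- `P` is order-acceptable with respect to the set `S` of atomic queries.  As usual, the clause
that is unified with `A` is renamed apart from `A`. -/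
def OrderAcceptable (P : Program L) (S : Set (Atom L)) : Prop :=
  ∃ ge : ExtHerbrand L → ExtHerbrand L → Prop,
    IsQuasiOrdering ge ∧ IsWellFounded ge ∧
    ∀ A ∈ Call P S, ∀ c₀ ∈ P, ∀ c : Clause L, c₀.IsVariant c → Disjoint c.vars A.vars →
    ∀ θ : Subst L, IsMGU θ A c.head →
    ∀ i : Fin c.body.length, MutRec P (c.body.get i).pred A.pred →
    ∀ σ : Subst L, IsComputedAnswer P (Query.subst (c.body.take i) θ) σ →
      Gt ge A.cls (((c.body.get i).subst θ).subst σ).cls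

end LogicProgramming

-- The given ordering itself witnesses order-acceptability. If `A` is a call, `θ` unifies it with a
-- clause head and the earlier body atoms, instantiated by `θσ`, are consequences of `P`, then these
-- instances lie in the interargument relations. The decrease hypothesis therefore applies to the
-- instance `Aθσ` of the head, and rigidity replaces `Aθσ` by `A` (`gt_of_entails`). Computed
-- answers give such consequences by soundness (`IsComputedAnswer.entails`).
--
-- For termination, an infinite LD-tree is finitely branching and has an infinite branch. Along it,
-- start from a selected atom below which the query never shrinks. At the first later moment of
-- minimal query length, the body atoms to the left have been refuted, hence are entailed, and an
-- instance of the next body atom is selected and again never removed (`exists_next`). Iteration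
-- gives an infinite chain of calls. `P` has finitely many predicates, so consecutive ones are
-- eventually mutually recursive (`eventually_mutRec`), and the chain then descends strictly,
-- contradicting well-foundedness.

namespace LogicProgramming

open FirstOrder.Language

-- Algebra of substitutions and renamings.

section Substitutions

variable {L : FirstOrder.Language.{u, v}}

theorem Subst.ext {θ σ : Subst L} (h : ∀ x, θ.toFun x = σ.toFun x) : θ = σ := by
  cases θ
  cases σ
  congr
  exact funext h

theorem term_subst_subst {α β γ : Type*} (t : L.Term α) (f : α → L.Term β) (g : β → L.Term γ) :
    (t.subst f).subst g = t.subst fun x => (f x).subst g := by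
  induction t with
  | var => rfl
  | func F ts ih => simp [Term.subst, ih]

theorem term_subst_congr {t : L.Term ℕ} {f g : ℕ → L.Term ℕ} (h : ∀ x ∈ t.varFinset, f x = g x) :
    t.subst f = t.subst g := by
  induction t with
  | var x => exact h x (by simp [Term.varFinset])
  | func F ts ih =>
    simp only [Term.subst, Term.func.injEq, heq_eq_eq, true_and]
    funext i
    refine ih i fun x hx => h x ?_
    simpa [Term.varFinset] using ⟨i, hx⟩

theorem term_relabel_subst {α β γ : Type*} (t : L.Term α) (e : α → β) (f : β → L.Term γ) :
    (t.relabel e).subst f = t.subst (f ∘ e) := by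
  induction t with
  | var => rfl
  | func F ts ih => simp [Term.subst, Term.relabel, ih]

theorem term_subst_var (t : L.Term ℕ) : t.subst Term.var = t := by
  induction t with
  | var => rfl
  | func F ts ih => simp [Term.subst, ih]

theorem Subst.comp_assoc (θ σ τ : Subst L) : (θ.comp σ).comp τ = θ.comp (σ.comp τ) :=
  Subst.ext fun x => term_subst_subst (θ.toFun x) _ _

theorem Subst.id_comp (θ : Subst L) : (Subst.id L).comp θ = θ :=
  Subst.ext fun _ => rfl

theorem Subst.comp_id (θ : Subst L) : θ.comp (Subst.id L) = θ :=
  Subst.ext fun x => term_subst_var (θ.toFun x)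

theorem composeMGUs_append_singleton (d : List (Step L)) (s : Step L) :
    composeMGUs (d ++ [s]) = (composeMGUs d).comp s.mgu := by
  induction d with
  | nil => exact (Subst.comp_id _).trans (Subst.id_comp _).symm
  | cons a d ih =>
    simp only [composeMGUs, List.cons_append, List.foldr_cons] at ih ⊢
    rw [ih, Subst.comp_assoc]

theorem Atom.subst_id (A : Atom L) : A.subst (Subst.id L) = A := by
  cases A
  simp [Atom.subst, Subst.id, term_subst_var]

theorem Atom.subst_comp (A : Atom L) (θ σ : Subst L) :
    A.subst (θ.comp σ) = (A.subst θ).subst σ := by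
  simp [Atom.subst, Subst.comp, term_subst_subst]

theorem Atom.subst_congr {A : Atom L} {θ σ : Subst L}
    (h : ∀ x ∈ A.vars, θ.toFun x = σ.toFun x) : A.subst θ = A.subst σ := by
  simp only [Atom.subst, Atom.mk.injEq, heq_eq_eq, true_and]
  funext i
  exact term_subst_congr fun x hx => h x (Set.mem_iUnion.2 ⟨i, hx⟩)

theorem Atom.pred_rename (e : Equiv.Perm ℕ) (A : Atom L) : (A.rename e).pred = A.pred := rfl

theorem Atom.rename_one (A : Atom L) : A.rename 1 = A := by
  cases A
  simp [Atom.rename, Equiv.Perm.coe_one, Term.relabel_id]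

theorem Atom.finite_vars (A : Atom L) : A.vars.Finite :=
  Set.finite_iUnion fun _ => Finset.finite_toSet _

theorem Query.finite_vars (Q : Query L) : (Query.vars Q).Finite := by
  have h : Query.vars Q = ⋃ A ∈ {A | A ∈ Q}, A.vars := by
    ext x
    simp [Query.vars]
  rw [h]
  exact (List.finite_toSet Q).biUnion fun A _ => A.finite_vars

theorem Clause.finite_vars (c : Clause L) : c.vars.Finite :=
  c.head.finite_vars.union (Query.finite_vars c.body)

theorem Atom.subst_restrict {A : Atom L} {V : Set ℕ} (h : A.vars ⊆ V) (σ : Subst L) :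
    A.subst (σ.restrict V) = A.subst σ :=
  Atom.subst_congr fun _ hx => if_pos (h hx)

open Classical in
/-- On atoms over a finite set of variables, a renaming followed by a substitution is a
substitution. -/
theorem exists_subst_rename (e : Equiv.Perm ℕ) (θ : Subst L) {V : Set ℕ} (hV : V.Finite) :
    ∃ η : Subst L, ∀ A : Atom L, A.vars ⊆ V → A.subst η = (A.rename e).subst θ := by
  -- The permutation `e` may move infinitely many variables, so the cutoff to `V` is what makes the
  -- domain finite.
  refine ⟨⟨fun x => if x ∈ V then θ.toFun (e x) else Term.var x, hV.subset ?_⟩, ?_⟩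
  · intro x hx
    by_contra h
    exact hx (if_neg h)
  · intro A hA
    simp only [Atom.subst, Atom.rename, Atom.mk.injEq, heq_eq_eq, true_and]
    funext i
    rw [term_relabel_subst]
    exact term_subst_congr fun x hx => if_pos (hA (Set.mem_iUnion.2 ⟨i, hx⟩))

theorem Query.subst_append (Q Q' : Query L) (θ : Subst L) :
    Query.subst (Q ++ Q') θ = Query.subst Q θ ++ Query.subst Q' θ :=
  List.map_append

theorem Query.subst_comp (Q : Query L) (θ σ : Subst L) :
    Query.subst Q (θ.comp σ) = Query.subst (Query.subst Q θ) σ := by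
  simp [Query.subst, Atom.subst_comp]

theorem Query.subst_id (Q : Query L) : Query.subst Q (Subst.id L) = Q := by
  simp [Query.subst, Atom.subst_id]

theorem Query.length_subst (Q : Query L) (θ : Subst L) : (Query.subst Q θ).length = Q.length :=
  List.length_map _

end Substitutions

-- Soundness of a single resolution step.

section Soundness

variable {L : FirstOrder.Language.{u, v}} {M : Type*} [L.Structure M]

theorem Atom.holds_subst {w : ℕ → M} {A : Atom L} {θ : Subst L} :
    (A.subst θ).Holds w ↔ A.Holds fun x => (θ.toFun x).realize w := by
  simp [Atom.Holds, Atom.subst, Term.realize_subst]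

theorem Atom.holds_rename {w : ℕ → M} {A : Atom L} {e : Equiv.Perm ℕ} :
    (A.rename e).Holds w ↔ A.Holds (w ∘ e) := by
  simp [Atom.Holds, Atom.rename, Term.realize_relabel]

theorem Clause.TrueIn.of_isVariant {c c' : Clause L} (h : c.TrueIn M) (hv : c.IsVariant c') :
    c'.TrueIn M := by
  obtain ⟨e, rfl⟩ := hv
  intro w hw
  refine Atom.holds_rename.2 (h _ fun B hB => Atom.holds_rename.1 (hw _ ?_))
  exact List.mem_map_of_mem hB

/-- A resolution step on the query `Q` with result `Q'`, where the unifier need not be most general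
and the input clause need not be standardized apart. -/
def Resolves (P : Program L) (Q : Query L) (s : Step L) (Q' : Query L) : Prop :=
  s.clause ∈ P ∧ s.clause.IsVariant s.input ∧ ∃ A tl, Q = A :: tl ∧
    A.subst s.mgu = s.input.head.subst s.mgu ∧ Q' = Query.subst (s.input.body ++ tl) s.mgu

theorem holds_of_holds_body {A : Atom L} {c : Clause L} {θ : Subst L} {w : ℕ → M}
    (hc : c.TrueIn M) (hθ : A.subst θ = c.head.subst θ)
    (h : ∀ B ∈ Query.subst c.body θ, B.Holds w) : (A.subst θ).Holds w := by
  rw [hθ]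
  exact Atom.holds_subst.2 (hc _ fun B hB => Atom.holds_subst.1 (h _ (List.mem_map_of_mem hB)))

/-- One resolution step preserves the property that the current query implies `B`. -/
theorem holds_step {P : Program L} {Q Q' : Query L} {s : Step L} (h : Resolves P Q s Q')
    (hM : ∀ c ∈ P, c.TrueIn M) {B : Atom L}
    (hB : ∀ w : ℕ → M, (∀ A ∈ Q, A.Holds w) → B.Holds w) (w : ℕ → M)
    (hw : ∀ A ∈ Q', A.Holds w) : (B.subst s.mgu).Holds w := by
  obtain ⟨hc, hv, A, tl, rfl, hA, rfl⟩ := h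
  rw [Query.subst_append] at hw
  refine Atom.holds_subst.2 (hB _ fun C hC => Atom.holds_subst.1 ?_)
  rcases List.mem_cons.1 hC with rfl | hC
  · exact holds_of_holds_body ((hM _ hc).of_isVariant hv) hA
      fun D hD => hw D (List.mem_append_left _ hD)
  · exact hw _ (List.mem_append_right _ (List.mem_map_of_mem hC))

end Soundness

-- Soundness of derivations, and persistent atoms in infinite ones.

section Derivations

variable {L : FirstOrder.Language.{u, v}} {P : Program L}

theorem LDDerivation.snoc_inv {Q₀ Q : Query L} {d : List (Step L)} {s : Step L}
    (h : LDDerivation P Q₀ (d ++ [s]) Q) :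
    ∃ Q', LDDerivation P Q₀ d Q' ∧ Resolves P Q' s Q := by
  generalize hd : d ++ [s] = d' at h
  cases h with
  | nil => simp at hd
  | snoc s' h1 h2 h3 h4 h5 h6 =>
    obtain ⟨rfl, h⟩ := List.append_inj' hd rfl
    obtain rfl : s = s' := by simpa using h
    exact ⟨_, h1, h2, h3, _, _, rfl, h6.1, rfl⟩

theorem Resolves.unique {Q Q₁ Q₂ : Query L} {s : Step L} (h₁ : Resolves P Q s Q₁)
    (h₂ : Resolves P Q s Q₂) : Q₁ = Q₂ := by
  obtain ⟨-, -, A, tl, rfl, -, rfl⟩ := h₁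
  obtain ⟨-, -, A', tl', h, -, rfl⟩ := h₂
  obtain ⟨-, rfl⟩ := List.cons.inj h
  rfl

theorem LDDerivation.unique {Q₀ : Query L} {d : List (Step L)} {Q₁ Q₂ : Query L}
    (h₁ : LDDerivation P Q₀ d Q₁) (h₂ : LDDerivation P Q₀ d Q₂) : Q₁ = Q₂ := by
  induction d using List.reverseRecOn generalizing Q₁ Q₂ with
  | nil =>
    have key : ∀ {d : List (Step L)} {Q : Query L}, LDDerivation P Q₀ d Q → d = [] → Q = Q₀ := by
      intro d Q h hd
      cases h with
      | nil => rfl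
      | snoc => simp at hd
    rw [key h₁ rfl, key h₂ rfl]
  | append_singleton d s ih =>
    obtain ⟨Q, hd, hr⟩ := h₁.snoc_inv
    obtain ⟨Q', hd', hr'⟩ := h₂.snoc_inv
    obtain rfl := ih hd hd'
    exact hr.unique hr'

/-- Induction on the last step by `holds_step`. When `Q` is empty the hypothesis on `w` is vacuous,
so every atom of the initial query becomes valid under the composed unifiers. -/
theorem LDDerivation.sound {Q₀ Q : Query L} {d : List (Step L)} (h : LDDerivation P Q₀ d Q)
    {M : Type*} [L.Structure M] (hM : ∀ c ∈ P, c.TrueIn M) {B : Atom L} (hB : B ∈ Q₀) (w : ℕ → M)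
    (hw : ∀ A ∈ Q, A.Holds w) : (B.subst (composeMGUs d)).Holds w := by
  induction d using List.reverseRecOn generalizing Q w with
  | nil =>
    obtain rfl := h.unique .nil
    exact (Atom.subst_id B).symm ▸ hw B hB
  | append_singleton d s ih =>
    obtain ⟨Q', hd, hr⟩ := h.snoc_inv
    rw [composeMGUs_append_singleton, Atom.subst_comp]
    exact holds_step hr hM (ih hd) w hw

theorem IsComputedAnswer.entails {Q : Query L} {σ : Subst L} (h : IsComputedAnswer P Q σ)
    {B : Atom L} (hB : B ∈ Q) : Entails P (B.subst σ) := by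
  obtain ⟨d, hd, rfl⟩ := h
  intro M _ _ hM w
  rw [Atom.subst_restrict (show B.vars ⊆ Query.vars Q from fun x hx => ⟨B, hB, hx⟩)]
  exact hd.sound hM hB w (by simp)

/-- If the queries of a derivation that starts with `pre ++ suf` stay longer than `suf`, then the
instance of `suf` has not been touched. -/
theorem exists_remainder {Q : ℕ → Query L} {s : ℕ → Step L}
    (hres : ∀ n, Resolves P (Q n) (s n) (Q (n + 1))) {a : ℕ} {pre suf : Query L}
    (ha : Q a = pre ++ suf) (j : ℕ) (hj : ∀ k < j, suf.length < (Q (a + k)).length) :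
    ∃ (F : Query L) (σ : Subst L), Q (a + j) = F ++ Query.subst suf σ ∧
      ∀ B ∈ pre, ∀ (M : Type u) [L.Structure M], (∀ c ∈ P, c.TrueIn M) → ∀ w : ℕ → M,
        (∀ A ∈ F, A.Holds w) → (B.subst σ).Holds w := by
  induction j with
  | zero =>
    refine ⟨pre, Subst.id L, by rw [Query.subst_id]; exact ha, ?_⟩
    intro B hB M _ _ w hw
    rw [Atom.subst_id]
    exact hw B hB
  | succ j ih =>
    obtain ⟨F, σ, hQ, hF⟩ := ih fun k hk => hj k (hk.trans j.lt_succ_self)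
    have hlen := hj j j.lt_succ_self
    rw [hQ, List.length_append, Query.length_subst] at hlen
    obtain ⟨hc, hv, A, tl, hA, hu, hQ'⟩ := hres (a + j)
    -- By `hlen` the current query is longer than the instance of `suf`, so the selected atom
    -- belongs to `F`.
    cases F with
    | nil => simp at hlen
    | cons C F =>
      obtain ⟨rfl, rfl⟩ := List.cons.inj (hQ.symm.trans hA)
      refine ⟨Query.subst ((s (a + j)).input.body ++ F) (s (a + j)).mgu, σ.comp (s (a + j)).mgu,
        ?_, ?_⟩
      · rw [← add_assoc, hQ', Query.subst_comp, ← Query.subst_append, List.append_assoc]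
        rfl
      · intro B hB M _ hM w hw
        rw [Atom.subst_comp]
        exact holds_step (Q := C :: F) ⟨hc, hv, C, F, rfl, hu, rfl⟩ hM (hF B hB M hM) w hw

/-- In an infinite derivation, an atom that is never removed has an immediate descendant that is
selected later and never removed. -/
theorem exists_next {Q : ℕ → Query L} {s : ℕ → Step L}
    (hres : ∀ n, Resolves P (Q n) (s n) (Q (n + 1))) {n : ℕ}
    (hn : ∀ m ≥ n, (Q n).length ≤ (Q m).length) :
    ∃ n', (∀ m ≥ n', (Q n').length ≤ (Q m).length) ∧
      ∃ (pre : Query L) (B : Atom L) (post : Query L) (σ : Subst L),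
        (s n).input.body = pre ++ B :: post ∧
        (Q n').head? = some ((B.subst (s n).mgu).subst σ) ∧
        ∀ C ∈ pre, Entails P ((C.subst (s n).mgu).subst σ) := by
  classical
  -- `ℓ` is the least query length after step `n`, and `j` marks the first time it is attained.
  have hex : ∃ ℓ j, (Q (n + 1 + j)).length = ℓ := ⟨_, 0, rfl⟩
  obtain ⟨ℓ, hℓ, hmin⟩ : ∃ ℓ, (∃ j, (Q (n + 1 + j)).length = ℓ) ∧
      ∀ j, ℓ ≤ (Q (n + 1 + j)).length :=
    ⟨Nat.find hex, Nat.find_spec hex, fun j => Nat.find_min' hex ⟨j, rfl⟩⟩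
  obtain ⟨j, hj, hlt⟩ : ∃ j, (Q (n + 1 + j)).length = ℓ ∧
      ∀ k < j, ℓ < (Q (n + 1 + k)).length :=
    ⟨Nat.find hℓ, Nat.find_spec hℓ, fun k hk => lt_of_le_of_ne (hmin k)
      (Ne.symm (Nat.find_min hℓ hk))⟩
  obtain ⟨-, -, A, tl, hA, -, hQ⟩ := hres n
  have h1 : tl.length + 1 ≤ ℓ := by
    have := hn (n + 1 + j) (by omega)
    rwa [hA, List.length_cons, hj] at this
  have h2 : ℓ ≤ (s n).input.body.length + tl.length := by
    have := hmin 0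
    rwa [add_zero, hQ, Query.length_subst, List.length_append] at this
  -- `i` counts the body atoms gone when length `ℓ` is reached. The subtraction is exact by `h2`,
  -- and `h1` leaves at least one body atom.
  set i := (s n).input.body.length + tl.length - ℓ with hi
  have hib : i < (s n).input.body.length := by omega
  set B := (s n).input.body[i] with hB
  set pre := (s n).input.body.take i with hpre
  set post := (s n).input.body.drop (i + 1) with hpost
  have hbody : (s n).input.body = pre ++ B :: post := by
    rw [hB, hpre, hpost, ← List.drop_eq_getElem_cons hib, List.take_append_drop]
  have hsuf : (Query.subst (B :: post ++ tl) (s n).mgu).length = ℓ := by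
    rw [Query.length_subst, hpost]
    simp only [List.length_append, List.length_cons, List.length_drop]
    omega
  have hsplit : Q (n + 1) =
      Query.subst pre (s n).mgu ++ Query.subst (B :: post ++ tl) (s n).mgu := by
    rw [hQ, hbody, List.append_assoc, Query.subst_append]
  obtain ⟨F, σ, hF, hent⟩ := exists_remainder hres hsplit j (by rwa [hsuf])
  -- Nothing remains of the atoms before `B`, so `hent` derives their instances from no assumption
  -- at all.
  obtain rfl : F = [] := by
    have h := congrArg List.length hF
    rw [hj, List.length_append, Query.length_subst, hsuf] at h
    exact List.length_eq_zero_iff.1 (by omega)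
  refine ⟨n + 1 + j, ?_, pre, B, post, σ, hbody, ?_, ?_⟩
  · intro m hm
    obtain ⟨k, rfl⟩ := Nat.exists_eq_add_of_le hm
    rw [hj, add_assoc]
    exact hmin _
  · rw [hF]
    rfl
  · intro C hC M _ _ hM w
    exact hent _ (List.mem_map_of_mem hC) M hM w (by simp)

end Derivations

-- Mutual recursion along infinite chains, and the strict decrease.

section Descent

variable {L : FirstOrder.Language.{u, v}} {P : Program L}

/-- In an infinite sequence in which every predicate refers to the next, consecutive predicates are
mutually recursive from some point on. -/
theorem eventually_mutRec {p : ℕ → Pred L} (hp : ∀ n, Refers P (p n) (p (n + 1))) :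
    ∃ N, ∀ n ≥ N, MutRec P (p (n + 1)) (p n) := by
  have hdep : ∀ {m n}, m ≤ n → DependsOn P (p m) (p n) := by
    intro m n h
    induction n, h using Nat.le_induction with
    | base => exact .refl
    | succ n _ ih => exact .tail ih (hp n)
  have hfin : (Set.range p).Finite := by
    have hsub : Set.range p ⊆ (fun c : Clause L => c.head.pred) '' (P : Set (Clause L)) := by
      rintro _ ⟨n, rfl⟩
      obtain ⟨c, hc, h, -⟩ := hp n
      exact ⟨c, hc, h⟩
    exact (P.finite_toSet.image _).subset hsub
  have : Finite (Set.range p) := hfin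
  -- Some predicate recurs infinitely often. With `N` one of its positions, any `n ≥ N` is followed
  -- by a later return to `p N`, which depends on `p n`.
  obtain ⟨q, hq⟩ := Finite.exists_infinite_fiber (Set.rangeFactorization p)
  have hinf : ((Set.rangeFactorization p) ⁻¹' {q}).Infinite := Set.infinite_coe_iff.1 hq
  obtain ⟨N, hN⟩ := hinf.nonempty
  refine ⟨N, fun n hn => ⟨?_, hdep n.le_succ⟩⟩
  obtain ⟨m, hm, hlt⟩ := hinf.exists_gt n
  have heq : p m = p N := congrArg Subtype.val ((hm : _ = q).trans (hN : _ = q).symm)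
  have h1 : DependsOn P (p (n + 1)) (p m) := hdep hlt
  rw [heq] at h1
  exact h1.trans (hdep hn)

/-- The decrease from an atom on which the ordering is rigid to an instance of a body atom of a
clause that is applied to it. -/
theorem gt_of_entails {R : Pred L → Set (Atom L)}
    (hR : ∀ p, Occurs P p → IsValidInterarg P p (R p))
    {ge : ExtHerbrand L → ExtHerbrand L → Prop} (hge : IsQuasiOrdering ge)
    (hdec : ∀ c ∈ P, ∀ i : Fin c.body.length, MutRec P (c.body.get i).pred c.head.pred →
      ∀ θ : Subst L, (∀ B ∈ c.body.take i, B.subst θ ∈ R B.pred) →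
        Gt ge (c.head.subst θ).cls ((c.body.get i).subst θ).cls)
    {A : Atom L} (hA : ∀ θ : Subst L, Equi ge A.cls (A.subst θ).cls)
    {c₀ c : Clause L} (hc₀ : c₀ ∈ P) (hv : c₀.IsVariant c) {θ : Subst L}
    (hθ : A.subst θ = c.head.subst θ) (i : Fin c.body.length)
    (hrec : MutRec P (c.body.get i).pred A.pred) {σ : Subst L}
    (hσ : ∀ B ∈ c.body.take i, Entails P ((B.subst θ).subst σ)) :
    Gt ge A.cls (((c.body.get i).subst θ).subst σ).cls := by
  obtain ⟨e, rfl⟩ := hv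
  -- The decrease hypothesis concerns clauses of `P` and not their variants, so the renaming is
  -- absorbed into the substitution.
  obtain ⟨η, hη⟩ := exists_subst_rename e (θ.comp σ) c₀.finite_vars
  have hbody : ∀ B ∈ c₀.body, B.subst η = ((B.rename e).subst θ).subst σ := fun B hB =>
    (hη B fun x hx => Or.inr ⟨B, hB, hx⟩).trans (Atom.subst_comp _ _ _)
  have hhead : c₀.head.subst η = A.subst (θ.comp σ) := by
    rw [hη _ fun x hx => Or.inl hx, Atom.subst_comp, Atom.subst_comp, hθ]
    rfl
  have hpred : A.pred = c₀.head.pred :=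
    (congrArg Atom.pred hθ : (A.subst θ).pred = ((c₀.head.rename e).subst θ).pred)
  obtain ⟨i, hi⟩ := i
  have hi' : i < c₀.body.length := by simpa [Clause.rename] using hi
  have hget : (c₀.rename e).body.get ⟨i, hi⟩ = (c₀.body.get ⟨i, hi'⟩).rename e := by
    simp [Clause.rename]
  rw [hget] at hrec ⊢
  rw [hpred, Atom.pred_rename] at hrec
  have hgt := hdec c₀ hc₀ ⟨i, hi'⟩ hrec η (by
    intro B hB
    have hBm : B ∈ c₀.body := List.mem_of_mem_take hB
    rw [hbody B hBm]
    refine (hR B.pred ⟨c₀, hc₀, Or.inr ⟨B, hBm, rfl⟩⟩).valid _ rfl (hσ _ ?_)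
    simp only [Clause.rename, ← List.map_take]
    exact List.mem_map_of_mem hB)
  rw [hhead, hbody _ (List.get_mem _ _)] at hgt
  have hr := hA (θ.comp σ)
  exact ⟨hge.trans _ _ _ hr.1 hgt.1, fun h => hgt.2 (hge.trans _ _ _ h hr.1)⟩

end Descent

-- König's lemma for LD-trees.

section Trees

variable {L : FirstOrder.Language.{u, v}} {P : Program L}

theorem IsLDTree.mem_of_prefix {G : Query L} {T : Set (List (Step L))} (hT : IsLDTree P G T)
    {d d' : List (Step L)} (h : d <+: d') (hd' : d' ∈ T) : d ∈ T := by
  obtain ⟨t, rfl⟩ := h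
  induction t using List.reverseRecOn with
  | nil => simpa using hd'
  | append_singleton t s ih => exact ih (hT.parent _ s (by simpa using hd'))

theorem IsLDTree.finite_children {G : Query L} {T : Set (List (Step L))} (hT : IsLDTree P G T)
    {d : List (Step L)} (hd : d ∈ T) : {s | d ++ [s] ∈ T}.Finite := by
  have hder : ∀ s ∈ {s | d ++ [s] ∈ T}, s.clause ∈ P ∧
      ∃ s' Q, s'.clause = s.clause ∧ LDDerivation P G (d ++ [s']) Q := by
    intro s hs
    obtain ⟨Q, hQ⟩ := hT.branch _ hs
    obtain ⟨_, -, hr⟩ := hQ.snoc_inv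
    exact ⟨hr.1, s, Q, rfl, hQ⟩
  -- A child is determined by its program clause, and `P` is finite.
  refine Set.Finite.of_finite_image (f := Step.clause)
    (P.finite_toSet.subset (Set.image_subset_iff.2 fun s hs => (hder s hs).1)) ?_
  intro s hs s' hs' h
  obtain ⟨hc, hex⟩ := hder s hs
  exact (hT.child d hd _ hc hex).unique ⟨rfl, hs⟩ ⟨h.symm, hs'⟩

/-- An infinite LD-tree has an infinite branch. -/
theorem IsLDTree.exists_infinite_branch {G : Query L} {T : Set (List (Step L))}
    (hT : IsLDTree P G T) (hinf : T.Infinite) :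
    ∃ (d : ℕ → List (Step L)) (s : ℕ → Step L), d 0 = [] ∧ (∀ n, d (n + 1) = d n ++ [s n]) ∧
      ∀ n, d n ∈ T := by
  -- Nodes with infinitely many descendants; finite branching gives each of them a child of the same
  -- kind.
  let X := {d : List (Step L) // {d' ∈ T | d <+: d'}.Infinite}
  have hmem : ∀ d : X, d.1 ∈ T := by
    intro d
    obtain ⟨d', hd', hp⟩ := d.2.nonempty
    exact hT.mem_of_prefix hp hd'
  have hstep : ∀ d : X, ∃ s, {d' ∈ T | d.1 ++ [s] <+: d'}.Infinite := by
    intro d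
    by_contra! hcon
    refine d.2 (((Set.finite_singleton d.1).union ((hT.finite_children (hmem d)).biUnion
      fun s _ => hcon s)).subset ?_)
    rintro d' ⟨hd', t, rfl⟩
    cases t with
    | nil => exact Or.inl (by simp)
    | cons s t =>
      have hp : d.1 ++ [s] <+: d.1 ++ s :: t := ⟨t, by simp⟩
      exact Or.inr (Set.mem_biUnion (hT.mem_of_prefix hp hd') ⟨hd', hp⟩)
  choose f hf using hstep
  let d : ℕ → X := fun n => Nat.rec ⟨[], by simpa using hinf⟩ (fun _ x => ⟨x.1 ++ [f x], hf x⟩) n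
  exact ⟨fun n => (d n).1, fun n => f (d n), rfl, fun _ => rfl, fun n => hmem (d n)⟩

end Trees

end LogicProgramming

-- Termination and the main theorem.

open LogicProgramming in
theorem LogicProgramming.ldTerminates_of_decrease {L : FirstOrder.Language.{u, v}}
    {S : Set (Atom L)} {P : Program L} {R : Pred L → Set (Atom L)}
    (hR : ∀ p, Occurs P p → IsValidInterarg P p (R p))
    {ge : ExtHerbrand L → ExtHerbrand L → Prop} (hge : IsQuasiOrdering ge)
    (hwf : IsWellFounded ge) (hrigid : IsRigidOn ge (Call P S))
    (hdec : ∀ c ∈ P, ∀ i : Fin c.body.length, MutRec P (c.body.get i).pred c.head.pred →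
      ∀ θ : Subst L, (∀ B ∈ c.body.take i, B.subst θ ∈ R B.pred) →
        Gt ge (c.head.subst θ).cls ((c.body.get i).subst θ).cls)
    {G : Atom L} (hG : G ∈ S) : LDTerminates P [G] := by
  intro T hT
  by_contra hinf
  obtain ⟨d, s, hd0, hds, hdT⟩ := hT.exists_infinite_branch hinf
  choose Q hQ using fun n => hT.branch _ (hdT n)
  have hres : ∀ n, Resolves P (Q n) (s n) (Q (n + 1)) := by
    intro n
    have h := hQ (n + 1)
    rw [hds] at h
    obtain ⟨Q', hQ', hr⟩ := h.snoc_inv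
    rwa [(hQ n).unique hQ']
  -- The chain can start at time `0`: the initial query has length one, and no query of the infinite
  -- branch is empty since each is resolved further.
  have hlen : ∀ m ≥ 0, (Q 0).length ≤ (Q m).length := by
    intro m _
    have h0 : Q 0 = [G] := (hQ 0).unique (hd0 ▸ .nil)
    obtain ⟨-, -, A, tl, hA, -⟩ := hres m
    simp [h0, hA]
  -- Times whose selected atom is never removed; `exists_next` leads from one to another.
  let X := {n : ℕ // ∀ m ≥ n, (Q n).length ≤ (Q m).length}
  choose next hnext pre B post σ hbody hhead hent using fun n : X => exists_next hres n.2
  let k : ℕ → X := fun j => Nat.rec ⟨0, hlen⟩ (fun _ x => ⟨next x, hnext x⟩) j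
  choose hc hv A tl hA hu hQ' using hres
  have hcall : ∀ n, A n ∈ Call P S := by
    intro n
    refine ⟨G, hG, d n, 1, tl n, ?_⟩
    rw [Atom.rename_one, ← hA]
    exact hQ n
  have hsel : ∀ j, A (k (j + 1)).1 = ((B (k j)).subst (s (k j).1).mgu).subst (σ (k j)) := by
    intro j
    have h := hhead (k j)
    change (Q (k (j + 1)).1).head? = _ at h
    rw [hA] at h
    exact Option.some.inj h
  have hpred : ∀ n, (A n).pred = (s n).clause.head.pred := by
    intro n
    obtain ⟨e, he⟩ := hv n
    have h := congrArg Atom.pred (hu n)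
    rw [he] at h
    exact h
  have href : ∀ j, Refers P (A (k j).1).pred (A (k (j + 1)).1).pred := by
    intro j
    refine ⟨_, hc _, (hpred _).symm, ?_⟩
    have hB : B (k j) ∈ (s (k j).1).input.body := by simp [hbody]
    obtain ⟨e, he⟩ := hv (k j).1
    rw [he] at hB
    obtain ⟨C, hC, hCB⟩ := List.mem_map.1 hB
    refine ⟨C, hC, ?_⟩
    rw [hsel, ← hCB]
    rfl
  obtain ⟨N, hN⟩ := eventually_mutRec href
  -- The shift by `N` discards the initial part where mutual recursion may fail.
  refine hwf ⟨fun j => (A (k (N + j)).1).cls, fun j => ?_⟩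
  have hrec := hN (N + j) (Nat.le_add_right _ _)
  change Gt ge _ (A (k (N + j + 1)).1).cls
  rw [hsel] at hrec ⊢
  have hi : (pre (k (N + j))).length < (s (k (N + j)).1).input.body.length := by
    simp [hbody]
  have hget : (s (k (N + j)).1).input.body.get ⟨_, hi⟩ = B (k (N + j)) := by
    simp [hbody]
  have hgt := gt_of_entails hR hge hdec (hrigid _ (hcall _)) (hc _) (hv _) (hu _) ⟨_, hi⟩
    (σ := σ (k (N + j))) (by rw [hget]; exact hrec) (by
      intro C hC
      refine hent _ C ?_
      simpa [hbody] using hC)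
  rwa [hget] at hgt

theorem mainTheorem2 {L : FirstOrder.Language.{u, v}}
    (S : Set (LogicProgramming.Atom L)) (P : LogicProgramming.Program L)
    (ge : LogicProgramming.ExtUniverse L → LogicProgramming.ExtUniverse L → Prop)
    (hge : LogicProgramming.IsQuasiOrdering ge)
    (R : LogicProgramming.Pred L → Set (LogicProgramming.Atom L))
    (hR : ∀ p, LogicProgramming.Occurs P p → LogicProgramming.IsValidInterarg P p (R p))
    (hext : ∃ ge' : LogicProgramming.ExtHerbrand L → LogicProgramming.ExtHerbrand L → Prop,
      LogicProgramming.IsQuasiOrdering ge' ∧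
      LogicProgramming.IsWellFounded ge' ∧
      LogicProgramming.IsProperExtension ge ge' ∧
      LogicProgramming.IsRigidOn ge' (LogicProgramming.Call P S) ∧
      ∀ c ∈ P, ∀ i : Fin c.body.length,
        LogicProgramming.MutRec P (c.body.get i).pred c.head.pred →
        ∀ θ : LogicProgramming.Subst L,
          (∀ B ∈ c.body.take i, B.subst θ ∈ R B.pred) →
          LogicProgramming.Gt ge' (c.head.subst θ).cls ((c.body.get i).subst θ).cls) :
    LogicProgramming.OrderAcceptable P S ∧
      ∀ G ∈ S, LogicProgramming.LDTerminates P [G] := by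
  obtain ⟨ge', hqo, hwf, -, hrigid, hdec⟩ := hext
  refine ⟨⟨ge', hqo, hwf, ?_⟩, fun G hG =>
    LogicProgramming.ldTerminates_of_decrease hR hqo hwf hrigid hdec hG⟩
  intro A hA c₀ hc₀ c hv _ θ hθ i hrec σ hσ
  exact LogicProgramming.gt_of_entails hR hqo hdec (hrigid A hA) hc₀ hv hθ.1 i hrec
    fun B hB => hσ.entails (List.mem_map_of_mem hB)
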